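/- Let $k$ be a field of characteristic zero. The Onsager algebra $\mathcal{O}$ is the Lie algebra over $k$ with vector space basis $\{A_m, G_l \mid m\in\mathbb{Z},\ l\in\mathbb{Z}_{>0}\}$ and antisymmetric bracket determined by $$[A_l,A_m]=2G_{l-m}\ \ (l>m),\qquad [G_l,A_m]=A_{m+l}-A_{m-l},\qquad [G_l,G_m]=0 .$$ The tetrahedron algebra $\boxtimes$ is the Lie algebra over $k$ with generators $X_{ij}$ ($i,j\in\{0,1,2,3\}$, $i\neq j$) and relations $$X_{ij}+X_{ji}=0\quad\text{for } i\neq j,$$ $$[X_{ij},X_{jk}]=2(X_{ij}+X_{jk})\quad\text{for mutually distinct } i,j,k,$$ $$[X_{hi},[X_{hi},[X_{hi},X_{jk}]]]=4[X_{hi},X_{jk}]\quad\text{for mutually distinct } h,i,j,k.$$ For mutually distinct $h,i,j,k\in\{0,1,2,3\}$, the Lie subalgebra of $\boxtimes$ generated by $X_{hi}$ and $X_{jk}$ is isomorphic, as a Lie algebra over $k$, to the Onsager algebra $\mathcal{O}$. -/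

import Mathlib

/-! ### The Onsager algebra -/

/-- The underlying vector space of the Onsager algebra: the free module with a basis consisting
of the elements `A m` (`m : ℤ`, index `Sum.inl m`) and `G l` (`l : ℕ+`, index `Sum.inr l`). -/
def OnsagerAlgebra (K : Type*) [CommRing K] : Type _ := (ℤ ⊕ ℕ+) →₀ K

namespace OnsagerAlgebra

variable (K : Type*) [CommRing K]

noncomputable instance : AddCommGroup (OnsagerAlgebra K) := inferInstanceAs (AddCommGroup ((ℤ ⊕ ℕ+) →₀ K))

noncomputable instance : Module K (OnsagerAlgebra K) := inferInstanceAs (Module K ((ℤ ⊕ ℕ+) →₀ K))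

/-- The defining basis `{A m, G l | m ∈ ℤ, l ∈ ℕ₊}`. -/
noncomputable def basis : Module.Basis (ℤ ⊕ ℕ+) K (OnsagerAlgebra K) := ⟨LinearEquiv.refl K _⟩

/-- The basis element `A m`. -/
noncomputable def A (m : ℤ) : OnsagerAlgebra K := basis K (Sum.inl m)

/-- The basis element `G l`, `l` a positive integer. -/
noncomputable def G (l : ℕ+) : OnsagerAlgebra K := basis K (Sum.inr l)

/-- The extension of `G` to all integers by `G (-l) = - G l` and `G 0 = 0`. -/
noncomputable def GInt (n : ℤ) : OnsagerAlgebra K :=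
  if h : 0 < n then G K (n.toNat.toPNat (by omega))
  else if h' : n < 0 then - G K ((-n).toNat.toPNat (by omega))
  else 0

/-- The products of basis elements:
`[A l, A m] = 2 G (l - m)`, `[A m, G l] = -(A (m + l) - A (m - l))`,
`[G l, A m] = A (m + l) - A (m - l)`, `[G l, G m] = 0`. -/
noncomputable def structureConst : ℤ ⊕ ℕ+ → ℤ ⊕ ℕ+ → OnsagerAlgebra K
  | .inl l, .inl m => (2 : K) • GInt K (l - m)
  | .inl m, .inr l => -(A K (m + (l : ℕ)) - A K (m - (l : ℕ)))
  | .inr l, .inl m => A K (m + (l : ℕ)) - A K (m - (l : ℕ))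
  | .inr _, .inr _ => 0

/-- The bilinear product with the prescribed values on the basis. -/
noncomputable def product : OnsagerAlgebra K →ₗ[K] OnsagerAlgebra K →ₗ[K] OnsagerAlgebra K :=
  (basis K).constr K fun a => (basis K).constr K fun b => structureConst K a b

noncomputable instance : Bracket (OnsagerAlgebra K) (OnsagerAlgebra K) := ⟨fun x y => product K x y⟩

theorem lie_def (x y : OnsagerAlgebra K) : ⁅x, y⁆ = product K x y := rfl

theorem product_basis (a b : ℤ ⊕ ℕ+) :
    product K (basis K a) (basis K b) = structureConst K a b := by
  simp [product, Module.Basis.constr_basis]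

theorem GInt_coe (l : ℕ+) : GInt K ((l : ℕ) : ℤ) = G K l := by
  have : (0 : ℤ) < ((l : ℕ) : ℤ) := by exact_mod_cast l.pos
  rw [GInt, dif_pos this]
  rfl

theorem GInt_neg (n : ℤ) : GInt K (-n) = - GInt K n := by
  rcases lt_trichotomy n 0 with h | h | h
  · have h1 : ¬ 0 < n := by omega
    simp [GInt, h, h1]
  · simp [GInt, h]
  · have h1 : ¬ n < 0 := by omega
    simp [GInt, h, h1]

theorem exists_pnat (n : ℤ) : n = 0 ∨ ∃ p : ℕ+, n = (p : ℕ) ∨ n = -((p : ℕ) : ℤ) := by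
  rcases lt_trichotomy n 0 with h | h | h
  · refine .inr ⟨(-n).toNat.toPNat (by omega), .inr ?_⟩
    change n = -((-n).toNat : ℤ)
    omega
  · exact .inl h
  · refine .inr ⟨n.toNat.toPNat (by omega), .inl ?_⟩
    change n = (n.toNat : ℤ)
    omega

theorem product_A_A (l m : ℤ) : product K (A K l) (A K m) = (2 : K) • GInt K (l - m) :=
  product_basis K _ _

theorem product_GInt_A (l m : ℤ) :
    product K (GInt K l) (A K m) = A K (m + l) - A K (m - l) := by
  have key : ∀ l : ℕ+, product K (G K l) (A K m) = A K (m + (l : ℕ)) - A K (m - (l : ℕ)) :=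
    fun l => product_basis K _ _
  rcases exists_pnat l with rfl | ⟨p, rfl | rfl⟩
  · simp [GInt]
  · rw [GInt_coe, key]
  · rw [GInt_neg, GInt_coe, map_neg, LinearMap.neg_apply, key, sub_neg_eq_add, ← sub_eq_add_neg,
      neg_sub]

theorem product_basis_antisymm (a b : ℤ ⊕ ℕ+) :
    structureConst K a b = - structureConst K b a := by
  rcases a with l | l <;> rcases b with m | m <;> simp only [structureConst, neg_neg, neg_zero]
  rw [← neg_sub m l, GInt_neg, smul_neg]

theorem product_antisymm (x y : OnsagerAlgebra K) : product K x y = - product K y x := by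
  have : product K = -(product K).flip := by
    refine (basis K).ext fun a => (basis K).ext fun b => ?_
    simpa [product_basis] using product_basis_antisymm K a b
  exact LinearMap.congr_fun (LinearMap.congr_fun this x) y

theorem product_A_GInt (l m : ℤ) :
    product K (A K m) (GInt K l) = A K (m - l) - A K (m + l) := by
  rw [product_antisymm, product_GInt_A, neg_sub]

theorem product_G_G (l m : ℕ+) : product K (G K l) (G K m) = 0 := product_basis K _ _

theorem product_GInt_GInt (l m : ℤ) : product K (GInt K l) (GInt K m) = 0 := by
  have h0 : GInt K 0 = 0 := by simp [GInt]
  rcases exists_pnat l with rfl | ⟨p, rfl | rfl⟩ <;>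
    rcases exists_pnat m with rfl | ⟨q, rfl | rfl⟩ <;>
    simp [h0, GInt_neg, GInt_coe, product_G_G]

theorem induction_basis {P : OnsagerAlgebra K → Prop} (x : OnsagerAlgebra K)
    (zero : P 0) (add : ∀ x y, P x → P y → P (x + y))
    (smul : ∀ (c : K) (a : ℤ ⊕ ℕ+), P (c • basis K a)) : P x := by
  rw [← (basis K).linearCombination_repr x, Finsupp.linearCombination_apply]
  exact Finset.sum_induction _ P add zero fun a _ => smul _ a

theorem product_self (x : OnsagerAlgebra K) : product K x x = 0 := by
  induction x using induction_basis with
  | zero => simp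
  | add x y hx hy =>
    rw [map_add, map_add, LinearMap.add_apply, LinearMap.add_apply, hx, hy,
      product_antisymm K y x]
    abel
  | smul c a =>
    have h : product K (basis K a) (basis K a) = 0 := by
      rw [product_basis]
      rcases a with l | l <;> simp [structureConst, GInt]
    simp [h]

theorem basis_eq (a : ℤ ⊕ ℕ+) : (∃ m, basis K a = A K m) ∨ ∃ l, basis K a = GInt K l := by
  rcases a with m | l
  · exact .inl ⟨m, rfl⟩
  · exact .inr ⟨_, (GInt_coe K l).symm⟩

theorem jacobi_basis (a b c : ℤ ⊕ ℕ+) :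
    product K (basis K a) (product K (basis K b) (basis K c)) =
      product K (product K (basis K a) (basis K b)) (basis K c) +
        product K (basis K b) (product K (basis K a) (basis K c)) := by
  rcases basis_eq K a with ⟨l, ha⟩ | ⟨l, ha⟩ <;> rcases basis_eq K b with ⟨m, hb⟩ | ⟨m, hb⟩ <;>
    rcases basis_eq K c with ⟨n, hc⟩ | ⟨n, hc⟩ <;> rw [ha, hb, hc] <;>
    simp only [product_A_A, product_GInt_A, product_A_GInt, product_GInt_GInt, map_sub, map_smul,
      LinearMap.sub_apply, LinearMap.smul_apply, map_zero, LinearMap.zero_apply, smul_zero,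
      add_zero, zero_add]
  · rw [show n + (l - m) = l + n - m by ring, show n - (l - m) = m + n - l by ring,
      show l - (m - n) = l + n - m by ring, show l + (m - n) = l + m - n by ring,
      show m - (l - n) = m + n - l by ring, show m + (l - n) = l + m - n by ring]
    module
  · rw [show l - (m - n) = l - m + n by ring, show l - (m + n) = l - m - n by ring,
      show m - (l - n) = -(l - m - n) by ring, show m - (l + n) = -(l - m + n) by ring,
      GInt_neg, GInt_neg]
    module
  · rw [show l - (n + m) = l - n - m by ring, show l - (n - m) = l - n + m by ring,
      show l - m - n = l - n - m by ring, show l + m - n = l - n + m by ring]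
  · rw [show l - n - m = l - m - n by ring, show l - n + m = l + m - n by ring,
      show l + n - m = l - m + n by ring, show l + n + m = l + m + n by ring]
    module
  · rw [show m + l - n = m - n + l by ring, show m - l - n = m - n - l by ring,
      show m - (n + l) = m - n - l by ring, show m - (n - l) = m - n + l by ring]
    module
  · rw [show m - n + l = m + l - n by ring, show m - n - l = m - l - n by ring,
      show m + n + l = m + l + n by ring, show m + n - l = m - l + n by ring]
    module
  · rw [show n + m + l = n + l + m by ring, show n + m - l = n - l + m by ring,
      show n - m + l = n + l - m by ring, show n - m - l = n - l - m by ring]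
    module

theorem product_leibniz (x y z : OnsagerAlgebra K) :
    product K x (product K y z) = product K (product K x y) z + product K y (product K x z) := by
  induction x using induction_basis with
  | zero => simp
  | add x x' hx hx' => simp only [map_add, LinearMap.add_apply, hx, hx']; abel
  | smul c a =>
    induction y using induction_basis with
    | zero => simp
    | add y y' hy hy' => simp only [map_add, LinearMap.add_apply, hy, hy']; abel
    | smul d b =>
      induction z using induction_basis with
      | zero => simp
      | add z z' hz hz' => simp only [map_add, hz, hz']; abel
      | smul e b' =>
        simp only [map_smul, LinearMap.smul_apply]
        rw [jacobi_basis K a b b']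
        module

noncomputable instance : LieRing (OnsagerAlgebra K) where
  add_lie x y z := by simp only [lie_def, map_add, LinearMap.add_apply]
  lie_add x y z := by simp only [lie_def, map_add]
  lie_self x := product_self K x
  leibniz_lie x y z := product_leibniz K x y z

noncomputable instance : LieAlgebra K (OnsagerAlgebra K) where
  lie_smul c x y := by simp only [lie_def, map_smul]

/-- The relation `[A l, A m] = 2 G (l - m)` for `l > m`. -/
theorem lie_A_A (l m : ℤ) (h : m < l) :
    ⁅A K l, A K m⁆ = (2 : K) • G K ((l - m).toNat.toPNat (by omega)) := by
  rw [lie_def, product_A_A, GInt, dif_pos (by omega)]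

/-- The relation `[G l, A m] = A (m + l) - A (m - l)`. -/
theorem lie_G_A (l : ℕ+) (m : ℤ) :
    ⁅G K l, A K m⁆ = A K (m + (l : ℕ)) - A K (m - (l : ℕ)) :=
  product_basis K _ _

/-- The relation `[G l, G m] = 0`. -/
theorem lie_G_G (l m : ℕ+) : ⁅G K l, G K m⁆ = 0 := product_G_G K l m

end OnsagerAlgebra

/-! ### The tetrahedron algebra -/

namespace TetrahedronAlgebra

/-- The index set `{(i, j) | i, j ∈ {0, 1, 2, 3}, i ≠ j}` of the generators. -/
abbrev Index : Type := {p : Fin 4 × Fin 4 // p.1 ≠ p.2}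

variable (K : Type*) [CommRing K]

/-- The free generator with index `(i, j)`. -/
noncomputable def freeX (i j : Fin 4) (hij : i ≠ j) : FreeLieAlgebra K Index :=
  FreeLieAlgebra.of K ⟨(i, j), hij⟩

/-- The defining relators of the tetrahedron algebra, as elements of the free Lie algebra. -/
inductive IsRelator : FreeLieAlgebra K Index → Prop
  | antisymm (i j : Fin 4) (hij : i ≠ j) :
      IsRelator (freeX K i j hij + freeX K j i hij.symm)
  | triangle (i j k : Fin 4) (hij : i ≠ j) (hjk : j ≠ k) (hik : i ≠ k) :
      IsRelator (⁅freeX K i j hij, freeX K j k hjk⁆ -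
        (2 : K) • (freeX K i j hij + freeX K j k hjk))
  | dolanGrady (h i j k : Fin 4) (hhi : h ≠ i) (hhj : h ≠ j) (hhk : h ≠ k)
      (hij : i ≠ j) (hik : i ≠ k) (hjk : j ≠ k) :
      IsRelator (⁅freeX K h i hhi, ⁅freeX K h i hhi, ⁅freeX K h i hhi, freeX K j k hjk⁆⁆⁆ -
        (4 : K) • ⁅freeX K h i hhi, freeX K j k hjk⁆)

/-- The Lie ideal of the free Lie algebra generated by the relators. -/
noncomputable def relationIdeal : LieIdeal K (FreeLieAlgebra K Index) :=
  LieSubmodule.lieSpan K (FreeLieAlgebra K Index) {x | IsRelator K x}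

end TetrahedronAlgebra

/-- The tetrahedron algebra: the Lie algebra over `K` with generators `X i j`
(`i, j ∈ {0, 1, 2, 3}`, `i ≠ j`) and relations
`X i j + X j i = 0`,
`[X i j, X j k] = 2 (X i j + X j k)` for mutually distinct `i, j, k`,
`[X h i, [X h i, [X h i, X j k]]] = 4 [X h i, X j k]` for mutually distinct `h, i, j, k`. -/
abbrev TetrahedronAlgebra (K : Type*) [CommRing K] : Type _ :=
  FreeLieAlgebra K TetrahedronAlgebra.Index ⧸ TetrahedronAlgebra.relationIdeal K

/-- The generator `X i j` of the tetrahedron algebra. -/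
noncomputable def TetrahedronAlgebra.X (K : Type*) [CommRing K] (i j : Fin 4) (hij : i ≠ j) :
    TetrahedronAlgebra K :=
  LieSubmodule.Quotient.mk (TetrahedronAlgebra.freeX K i j hij)

/-! The pair `X h i`, `X j k` satisfies both Dolan-Grady relations, and these already present the
Onsager algebra. With `x` and `y` playing `A 0` and `A 1`, put g = [y, x]/2 and define A m in both
directions by [g, A m] = A (m + 1) - A (m - 1). The two Dolan-Grady relations say exactly that [A 0,
A (-1)] and [A 2, A 1] equal 2g. `dolanGrady_step` spreads this to all neighbours, and induction on
l - m yields the remaining relations, hence a morphism φ from the Onsager algebra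
(`exists_lieHom_of_dolanGrady`). Its range is generated by the images of `A 0` and `A 1`
(`range_eq_lieSpan`).

Injectivity of φ is detected by a representation. Distinct points of a field F attached to the four
indices send each generator to a 2 × 2 involution whose eigenlines are the two points
(`exists_lieHom_matrix`). For the points -1, 1, -s, s the composite with φ sends A m to the
antidiagonal matrix with entries s ^ m, s ^ (-m). When functionals separate the powers of s, as for
the Laurent series variable, these matrices determine all coordinates. -/

section
-- The inductive step for neighbouring elements.
variable {K L : Type*} [Field K] [CharZero K] [LieRing L] [LieAlgebra K L]

/-- The letters a, b, c, d, e, f, k are seven consecutive terms of the sequence. The element u = [e,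
c] plays 2 G 2: it equals the neighbouring brackets [d, b] and [f, d]. Its commutation with g is
proved first; applying ad u and ad g to known brackets then forces the value of [f, e]. -/
theorem dolanGrady_step {a b c d e f k g : L}
    (hb : ⁅g, b⁆ = c - a) (hc : ⁅g, c⁆ = d - b) (hd : ⁅g, d⁆ = e - c) (he : ⁅g, e⁆ = f - d)
    (hf : ⁅g, f⁆ = k - e)
    (hcb : ⁅c, b⁆ = (2 : K) • g) (hdc : ⁅d, c⁆ = (2 : K) • g) (hed : ⁅e, d⁆ = (2 : K) • g) :
    ⁅f, e⁆ = (2 : K) • g := by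
  have hbc : ⁅b, c⁆ = -((2 : K) • g) := by rw [← lie_skew, hcb]
  have hcd : ⁅c, d⁆ = -((2 : K) • g) := by rw [← lie_skew, hdc]
  have hde : ⁅d, e⁆ = -((2 : K) • g) := by rw [← lie_skew, hed]
  have hag : ∀ x : L, ⁅x, g⁆ = -⁅g, x⁆ := fun x => (lie_skew x g).symm
  have h1 : ⁅d, b⁆ = ⁅e, c⁆ := by
    have := leibniz_lie g d c
    simp only [hdc, hd, hc, lie_smul, lie_self, sub_lie, lie_sub] at this
    linear_combination (norm := module) this
  have h2 : ⁅f, d⁆ = ⁅e, c⁆ := by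
    have := leibniz_lie g e d
    simp only [hed, hd, he, lie_smul, lie_self, sub_lie, lie_sub] at this
    linear_combination (norm := module) -this
  have h3 : ⁅⁅e, c⁆, d⁆ = (2 : K) • (f - b) := by
    rw [lie_lie, hcd, hed, lie_neg, lie_smul, lie_smul, hag, hag, hc, he]
    module
  have h4 : ⁅⁅e, c⁆, c⁆ = (2 : K) • (e - a) := by
    rw [← h1, lie_lie, hdc, hbc, lie_neg, lie_smul, lie_smul, hag, hag, hd, hb]
    module
  have h5 := leibniz_lie ⁅e, c⁆ d c
  rw [h3, h4, hdc, lie_smul, hag ⁅e, c⁆] at h5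
  have h6 := leibniz_lie g e c
  have h7 := leibniz_lie g d b
  rw [h1] at h7
  simp only [hb, hc, hd, he, lie_sub, sub_lie, smul_lie, lie_smul, hed, hdc, hcb, hbc,
    hde] at h5 h6 h7
  -- Adding `h6` and `h7` gives 2[g, u] = [f, c] - [d, a], while `h5` says that this difference is
  -- -[g, u].
  have h8 : ⁅g, ⁅e, c⁆⁆ = 0 := by
    have : (6 : K) • ⁅g, ⁅e, c⁆⁆ = 0 := by
      linear_combination (norm := module) (2 : K) • h6 + (2 : K) • h7 - h5
    exact (smul_eq_zero.mp this).resolve_left (by norm_num)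
  have h9 : ⁅⁅e, c⁆, e⁆ = (2 : K) • (k - c) := by
    have := leibniz_lie g ⁅e, c⁆ d
    rw [h8, h3, hd, zero_lie, lie_sub ⁅e, c⁆, h4, lie_smul, lie_sub, hf, hb] at this
    linear_combination (norm := module) -this
  have h10 := leibniz_lie ⁅e, c⁆ e d
  rw [hed, lie_smul, hag ⁅e, c⁆, h8, h9, h3] at h10
  have h11 := leibniz_lie g f d
  rw [h2, h8] at h11
  rw [h8] at h6
  have h12 : ⁅e, f⁆ = -⁅f, e⁆ := (lie_skew e f).symm
  simp only [hf, hd, lie_sub, sub_lie, smul_lie, lie_smul, hed, hcd, h12] at h10 h11 h6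
  have : (4 : K) • ⁅f, e⁆ = (4 : K) • (2 : K) • g := by
    linear_combination (norm := module) h10 - (2 : K) • h11 - (2 : K) • h6
  exact smul_right_injective L (by norm_num : (4 : K) ≠ 0) this
end

/-! ### All Onsager relations from those between neighbours. -/

namespace OnsagerAlgebra
section
variable {K L : Type*} [Field K] [CharZero K] [LieRing L] [LieAlgebra K L]

theorem lie_succ_self_of_nonneg {A : ℤ → L} {g : L} (hg : ∀ m, ⁅g, A m⁆ = A (m + 1) - A (m - 1))
    (h0 : ⁅A 0, A (-1)⁆ = (2 : K) • g) (h1 : ⁅A 1, A 0⁆ = (2 : K) • g)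
    (h2 : ⁅A 2, A 1⁆ = (2 : K) • g) (n : ℕ) : ⁅A (n + 1), A n⁆ = (2 : K) • g := by
  suffices h : ⁅A n, A (n - 1)⁆ = (2 : K) • g ∧ ⁅A (n + 1), A n⁆ = (2 : K) • g ∧
      ⁅A (n + 2), A (n + 1)⁆ = (2 : K) • g from h.2.1
  induction n with
  | zero => simpa using ⟨h0, h1, h2⟩
  | succ n ih =>
    have key (m : ℤ) (a b c : ℤ) (hb : b = m + 1 := by omega) (ha : a = m - 1 := by omega) :
        ⁅g, A m⁆ = A b - A a := by rw [hb, ha, hg]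
    have := dolanGrady_step (key (n - 1 : ℤ) (n - 2) n 0) (key n (n - 1) (n + 1) 0)
      (key (n + 1) n (n + 2) 0) (key (n + 2) (n + 1) (n + 3) 0) (key (n + 3) (n + 2) (n + 4) 0)
      ih.1 ih.2.1 ih.2.2
    push_cast
    rw [show (n + 1 + 1 : ℤ) = n + 2 by ring, show (n + 1 + 2 : ℤ) = n + 3 by ring,
      show (n + 1 - 1 : ℤ) = n by ring]
    exact ⟨ih.2.1, ih.2.2, this⟩

theorem lie_succ_self {A : ℤ → L} {g : L} (hg : ∀ m, ⁅g, A m⁆ = A (m + 1) - A (m - 1))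
    (h0 : ⁅A 0, A (-1)⁆ = (2 : K) • g) (h1 : ⁅A 1, A 0⁆ = (2 : K) • g)
    (h2 : ⁅A 2, A 1⁆ = (2 : K) • g) (m : ℤ) : ⁅A (m + 1), A m⁆ = (2 : K) • g := by
  obtain ⟨n, rfl | rfl⟩ := m.eq_nat_or_neg
  · exact lie_succ_self_of_nonneg hg h0 h1 h2 n
  rcases n with _ | n
  · simpa using h1
  -- The reflection m ↦ 1 - m, g ↦ -g preserves the hypotheses and exchanges `h0` with `h2`.
  have := lie_succ_self_of_nonneg (K := K) (A := fun m => A (1 - m)) (g := -g)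
    (fun m => by
      rw [neg_lie, hg, neg_sub, show 1 - m - 1 = 1 - (m + 1) by ring,
        show 1 - m + 1 = 1 - (m - 1) by ring])
    (by rw [smul_neg, ← h2, lie_skew]; norm_num) (by rw [smul_neg, ← h1, lie_skew]; norm_num)
    (by rw [smul_neg, ← h0, lie_skew]; norm_num) (n + 1)
  push_cast at this ⊢
  rw [← lie_skew, smul_neg, neg_inj, show (1 - (n + 1 + 1) : ℤ) = -(n + 1) by ring,
    show (1 - (n + 1) : ℤ) = -(n + 1) + 1 by ring] at this
  exact this

variable {A : ℤ → L} {g : L}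

omit [CharZero K] in
-- Apply ad g to [A (m + n), A m] = 2u: the two terms with index gap n - 1 both equal 2t and cancel.
theorem lie_add_succ_sub (hg : ∀ m, ⁅g, A m⁆ = A (m + 1) - A (m - 1)) {n : ℤ} {t u : L}
    (ht : ∀ m, ⁅A (m + (n - 1)), A m⁆ = (2 : K) • t) (hu : ∀ m, ⁅A (m + n), A m⁆ = (2 : K) • u)
    (m : ℤ) : ⁅A (m + (n + 1)), A m⁆ - ⁅A (m - 1 + (n + 1)), A (m - 1)⁆ = (2 : K) • ⁅g, u⁆ := by
  have h := leibniz_lie g (A (m + n)) (A m)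
  have h1 := ht m
  have h2 := ht (m + 1)
  rw [show m + 1 + (n - 1) = m + n by ring] at h2
  rw [show m + (n - 1) = m + n - 1 by ring] at h1
  rw [show m + (n + 1) = m + n + 1 by ring, show m - 1 + (n + 1) = m + n by ring]
  rw [hu, hg, hg, sub_lie, lie_sub, lie_smul, h1, h2] at h
  linear_combination (norm := module) -h

omit [CharZero K] in
theorem lie_add_succ (hg : ∀ m, ⁅g, A m⁆ = A (m + 1) - A (m - 1)) {n : ℤ} {t u : L}
    (ht : ∀ m, ⁅A (m + (n - 1)), A m⁆ = (2 : K) • t) (hu : ∀ m, ⁅A (m + n), A m⁆ = (2 : K) • u)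
    (hgu : ⁅g, u⁆ = 0) (m : ℤ) : ⁅A (m + (n + 1)), A m⁆ = ⁅A (n + 1), A 0⁆ := by
  have h := lie_add_succ_sub hg ht hu
  simp only [hgu, smul_zero, sub_eq_zero] at h
  induction m with
  | zero => simp
  | succ i ih => rw [h, add_sub_cancel_right, ih]
  | pred i ih => rw [← h, ih]

/-- Write 2v = [A (m + 1), A (m - n)] and use Jacobi: the inner brackets with A m have gaps n and 1,
so they are known. -/
theorem lie_G_A_succ (hs : ∀ m, ⁅A (m + 1), A m⁆ = (2 : K) • g)
    (hg : ∀ m, ⁅g, A m⁆ = A (m + 1) - A (m - 1)) {n : ℤ} {u v : L}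
    (hu : ∀ m, ⁅A (m + n), A m⁆ = (2 : K) • u) (hv : ∀ m, ⁅A (m + (n + 1)), A m⁆ = (2 : K) • v)
    (huA : ∀ m, ⁅u, A m⁆ = A (m + n) - A (m - n)) (m : ℤ) :
    ⁅v, A m⁆ = A (m + (n + 1)) - A (m - (n + 1)) := by
  have h : ⁅(2 : K) • v, A m⁆ = (2 : K) • (A (m + (n + 1)) - A (m - (n + 1))) := by
    have e1 := hu (m - n)
    have e3 := hv (m - n)
    rw [sub_add_cancel] at e1
    rw [show m - n + (n + 1) = m + 1 by ring] at e3
    rw [← e3, lie_lie, ← lie_skew (A (m - n)), e1, ← lie_skew (A (m - n)), hs, lie_neg,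
      lie_smul, smul_lie, ← lie_skew (A (m + 1)), huA, hg,
      show m + 1 + n = m + (n + 1) by ring, show m - n - 1 = m - (n + 1) by ring,
      show m + 1 - n = m - n + 1 by ring]
    module
  rw [smul_lie] at h
  exact smul_right_injective L (two_ne_zero (α := K)) h

/-- The difference [A (n + 1), A 0] - [A 1, A (-n)] is computed twice. Telescoping over n shifts
gives 2n[g, u]; applying ad u to [A 1, A 0] = 2g gives -2[g, u]. Hence 2(n + 1)[g, u] = 0, and
characteristic zero finishes. -/
theorem lie_G_one_eq_zero (hs : ∀ m, ⁅A (m + 1), A m⁆ = (2 : K) • g)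
    (hg : ∀ m, ⁅g, A m⁆ = A (m + 1) - A (m - 1)) {n : ℕ} {t u : L}
    (ht : ∀ m, ⁅A (m + (n - 1)), A m⁆ = (2 : K) • t) (hu : ∀ m, ⁅A (m + n), A m⁆ = (2 : K) • u)
    (huA : ∀ m, ⁅u, A m⁆ = A (m + n) - A (m - n)) : ⁅g, u⁆ = 0 := by
  have h := lie_add_succ_sub hg ht hu
  have htel (k : ℕ) : ⁅A (n + 1), A 0⁆ - ⁅A (0 - k + (n + 1)), A (0 - k)⁆
      = (2 * k : K) • ⁅g, u⁆ := by
    induction k with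
    | zero => simp
    | succ k ih =>
      have := h (0 - k)
      rw [show (0 - k - 1 : ℤ) = 0 - (k + 1 : ℕ) by push_cast; ring] at this
      push_cast at this ih ⊢
      linear_combination (norm := module) ih + this
  have h1 := leibniz_lie u (A 1) (A 0)
  have h2 := hs 0
  have h3 := htel n
  have h4 := ht 1
  have h5 := ht (1 - n)
  rw [zero_add] at h2
  rw [show (1 + (n - 1) : ℤ) = n by ring] at h4
  rw [show (1 - n + (n - 1) : ℤ) = 0 by ring] at h5
  rw [show (0 - n + (n + 1) : ℤ) = 1 by ring, zero_sub] at h3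
  rw [h2, lie_smul, ← lie_skew, huA, huA, sub_lie, lie_sub, ← lie_skew (A (1 - n)), h5, zero_add,
    ← lie_skew (A 1) (A n), h4, add_comm 1 (n : ℤ), zero_sub] at h1
  have h6 : (2 * (n + 1 : ℕ) : K) • ⁅g, u⁆ = 0 := by
    push_cast
    linear_combination (norm := module) -h1 - h3
  exact (smul_eq_zero.mp h6).resolve_left
    (mul_ne_zero two_ne_zero (Nat.cast_ne_zero.mpr n.succ_ne_zero))

/-- The step from gap n to n + 1 uses gaps n - 1 and n, so the induction carries two consecutive
gaps. -/
theorem onsager_relations_nat (hs : ∀ m, ⁅A (m + 1), A m⁆ = (2 : K) • g)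
    (hg : ∀ m, ⁅g, A m⁆ = A (m + 1) - A (m - 1)) (n : ℕ) :
    (∀ m, ⁅A (m + n), A m⁆ = ⁅A n, A 0⁆) ∧
      ∀ m, ⁅(2⁻¹ : K) • ⁅A n, A 0⁆, A m⁆ = A (m + n) - A (m - n) := by
  have h2 (x : L) : (2 : K) • (2⁻¹ : K) • x = x := smul_inv_smul₀ two_ne_zero x
  suffices h : ∀ n : ℕ, ((∀ m, ⁅A (m + n), A m⁆ = ⁅A n, A 0⁆) ∧
        (∀ m, ⁅(2⁻¹ : K) • ⁅A n, A 0⁆, A m⁆ = A (m + n) - A (m - n))) ∧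
      (∀ m, ⁅A (m + (n + 1)), A m⁆ = ⁅A (n + 1), A 0⁆) ∧
        (∀ m, ⁅(2⁻¹ : K) • ⁅A (n + 1), A 0⁆, A m⁆ = A (m + (n + 1)) - A (m - (n + 1)))
    from (h n).1
  intro n
  induction n with
  | zero =>
    have h1 := hs 0
    rw [zero_add] at h1
    simp [hs, hg, h1, smul_smul]
  | succ n ih =>
    obtain ⟨⟨ih1, ih2⟩, ih3, ih4⟩ := ih
    have ht : ∀ m, ⁅A (m + ((n + 1 : ℕ) - 1)), A m⁆ = (2 : K) • (2⁻¹ : K) • ⁅A n, A 0⁆ := by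
      simpa [h2] using ih1
    have hu : ∀ m, ⁅A (m + (n + 1 : ℕ)), A m⁆ = (2 : K) • (2⁻¹ : K) • ⁅A (n + 1), A 0⁆ := by
      simpa [h2] using ih3
    have ih4' : ∀ m, ⁅(2⁻¹ : K) • ⁅A (n + 1), A 0⁆, A m⁆
        = A (m + (n + 1 : ℕ)) - A (m - (n + 1 : ℕ)) := by
      simpa using ih4
    have h5 := lie_add_succ hg ht hu (lie_G_one_eq_zero hs hg ht hu ih4')
    refine ⟨⟨by simpa using ih3, by simpa using ih4⟩, h5, ?_⟩
    exact lie_G_A_succ hs hg hu (fun m => by rw [h2, h5]) ih4'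

theorem lie_A_A_eq (hs : ∀ m, ⁅A (m + 1), A m⁆ = (2 : K) • g)
    (hg : ∀ m, ⁅g, A m⁆ = A (m + 1) - A (m - 1)) (l m : ℤ) : ⁅A l, A m⁆ = ⁅A (l - m), A 0⁆ := by
  have key (n : ℕ) (m : ℤ) := (onsager_relations_nat hs hg n).1 m
  obtain ⟨n, hn | hn⟩ := (l - m).eq_nat_or_neg
  · rw [hn, ← key n m, ← hn, add_sub_cancel]
  · have h1 := key n l
    have h2 := key n (-n)
    rw [show l + n = m by omega] at h1
    rw [neg_add_cancel] at h2
    rw [hn, ← lie_skew, h1, ← h2, lie_skew]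

theorem lie_G_A_eq (hs : ∀ m, ⁅A (m + 1), A m⁆ = (2 : K) • g)
    (hg : ∀ m, ⁅g, A m⁆ = A (m + 1) - A (m - 1)) (l m : ℤ) :
    ⁅(2⁻¹ : K) • ⁅A l, A 0⁆, A m⁆ = A (m + l) - A (m - l) := by
  obtain ⟨n, rfl | rfl⟩ := l.eq_nat_or_neg
  · exact (onsager_relations_nat hs hg n).2 m
  · have h := lie_A_A_eq hs hg 0 n
    rw [zero_sub] at h
    rw [← h, ← lie_skew (A 0), smul_neg, neg_lie, (onsager_relations_nat hs hg n).2 m, neg_sub,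
      sub_neg_eq_add, ← sub_eq_add_neg]

/-- Expanding the second G as a bracket leaves four brackets of A's with gaps m + l and m - l, which
cancel in pairs. -/
theorem lie_G_G_eq (hs : ∀ m, ⁅A (m + 1), A m⁆ = (2 : K) • g)
    (hg : ∀ m, ⁅g, A m⁆ = A (m + 1) - A (m - 1)) (l m : ℤ) :
    ⁅(2⁻¹ : K) • ⁅A l, A 0⁆, (2⁻¹ : K) • ⁅A m, A 0⁆⁆ = 0 := by
  rw [lie_smul, leibniz_lie, lie_G_A_eq hs hg, lie_G_A_eq hs hg, sub_lie, lie_sub,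
    lie_A_A_eq hs hg m, lie_A_A_eq hs hg m, zero_add, zero_sub, sub_neg_eq_add]
  simp

end

/-! ### Morphisms out of the Onsager algebra. -/

section lift
variable {K L : Type*} [Field K] [CharZero K] [LieRing L] [LieAlgebra K L]

/-- The linear map out of the Onsager algebra with prescribed values on the basis. -/
noncomputable def linearLift (K : Type*) {L : Type*} [Field K] [LieRing L] [LieAlgebra K L]
    (a b : ℤ → L) : OnsagerAlgebra K →ₗ[K] L :=
  (basis K).constr K (Sum.elim a fun l => b (l : ℕ))

omit [CharZero K] in
theorem linearLift_A (a b : ℤ → L) (m : ℤ) : linearLift K a b (A K m) = a m :=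
  Module.Basis.constr_basis ..

omit [CharZero K] in
theorem linearLift_G (a b : ℤ → L) (l : ℕ+) : linearLift K a b (G K l) = b (l : ℕ) :=
  Module.Basis.constr_basis ..

variable {a b : ℤ → L}

theorem linearLift_GInt (haa : ∀ l m, ⁅a l, a m⁆ = (2 : K) • b (l - m)) (n : ℤ) :
    linearLift K a b (GInt K n) = b n := by
  have hodd (n : ℤ) : b (-n) = -b n := by
    have h := haa 0 n
    rw [← lie_skew, haa n 0, sub_zero, zero_sub] at h
    apply smul_right_injective L (two_ne_zero (α := K))
    simp only [← h, smul_neg]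
  rcases exists_pnat n with rfl | ⟨p, rfl | rfl⟩
  · have h := haa 0 0
    rw [lie_self, sub_zero, eq_comm, smul_eq_zero] at h
    simp [GInt, h.resolve_left two_ne_zero]
  · rw [GInt_coe, linearLift_G]
  · rw [GInt_neg, GInt_coe, map_neg, linearLift_G, hodd]

/-- The Lie algebra morphism out of the Onsager algebra determined by a family satisfying the
defining relations. -/
noncomputable def lift (a b : ℤ → L) (haa : ∀ l m, ⁅a l, a m⁆ = (2 : K) • b (l - m))
    (hba : ∀ l m, ⁅b l, a m⁆ = a (m + l) - a (m - l)) (hbb : ∀ l m, ⁅b l, b m⁆ = 0) :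
    OnsagerAlgebra K →ₗ⁅K⁆ L where
  toLinearMap := linearLift K a b
  map_lie' {x y} := by
    change linearLift K a b ⁅x, y⁆ = ⁅linearLift K a b x, linearLift K a b y⁆
    rw [lie_def]
    induction x using induction_basis with
    | zero => simp
    | add x x' hx hx' => simp only [map_add, LinearMap.add_apply, hx, hx', add_lie]
    | smul c i =>
      induction y using induction_basis with
      | zero => simp
      | add y y' hy hy' => simp only [map_add, hy, hy', lie_add]
      | smul d j =>
        simp only [map_smul, LinearMap.smul_apply, smul_lie, lie_smul]
        congr 2
        rcases basis_eq K i with ⟨l, hi⟩ | ⟨l, hi⟩ <;>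
          rcases basis_eq K j with ⟨m, hj⟩ | ⟨m, hj⟩ <;> rw [hi, hj]
        · rw [product_A_A, map_smul, linearLift_GInt haa, linearLift_A, linearLift_A, haa]
        · rw [product_A_GInt, map_sub, linearLift_A, linearLift_A, linearLift_A,
            linearLift_GInt haa, ← lie_skew, hba, neg_sub]
        · rw [product_GInt_A, map_sub, linearLift_A, linearLift_A, linearLift_A,
            linearLift_GInt haa, hba]
        · rw [product_GInt_GInt, map_zero, linearLift_GInt haa, linearLift_GInt haa, hbb]

theorem lift_A (haa : ∀ l m, ⁅a l, a m⁆ = (2 : K) • b (l - m))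
    (hba : ∀ l m, ⁅b l, a m⁆ = a (m + l) - a (m - l))
    (hbb : ∀ l m, ⁅b l, b m⁆ = 0) (m : ℤ) : lift a b haa hba hbb (A K m) = a m :=
  linearLift_A a b m

/-- Any two elements satisfying the Dolan-Grady relations are the images of `A 0` and `A 1` under
a Lie algebra morphism. -/
theorem exists_lieHom_of_dolanGrady (x y : L)
    (hxy : ⁅x, ⁅x, ⁅x, y⁆⁆⁆ = (4 : K) • ⁅x, y⁆) (hyx : ⁅y, ⁅y, ⁅y, x⁆⁆⁆ = (4 : K) • ⁅y, x⁆) :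
    ∃ φ : OnsagerAlgebra K →ₗ⁅K⁆ L, φ (A K 0) = x ∧ φ (A K 1) = y := by
  let g : L := (2⁻¹ : K) • ⁅y, x⁆
  -- The second-order recursion is a shift on pairs (A m, A (m + 1)); as it is invertible, its
  -- integer powers define the sequence for negative m too.
  let T : Equiv.Perm (L × L) :=
    { toFun p := (p.2, p.1 + ⁅g, p.2⁆)
      invFun p := (p.2 - ⁅g, p.1⁆, p.1)
      left_inv p := by simp
      right_inv p := by simp }
  let B : ℤ → L := fun m => ((T ^ m) (x, y)).1
  have hT (m : ℤ) : (T ^ (m + 1)) (x, y) = T ((T ^ m) (x, y)) := by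
    rw [add_comm, zpow_one_add]; rfl
  have hB (m : ℤ) : ((T ^ m) (x, y)).2 = B (m + 1) := by simp only [B, hT]; rfl
  have hg (m : ℤ) : ⁅g, B m⁆ = B (m + 1) - B (m - 1) := by
    have h1 := hT (m - 1)
    have h2 := hB (m - 1)
    have h3 := hB m
    rw [sub_add_cancel] at h1 h2
    rw [← h3, h1, ← h2]
    simp [T, B]
  have hB0 : B 0 = x := rfl
  have hB1 : B 1 = y := rfl
  have h2g : ⁅y, x⁆ = (2 : K) • g := (smul_inv_smul₀ two_ne_zero _).symm
  have hxy' : ⁅x, y⁆ = -((2 : K) • g) := by rw [← lie_skew, h2g]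
  have hs := lie_succ_self (K := K) hg
    (by
      have h := hg 0
      rw [zero_add, zero_sub, hB0, hB1] at h
      rw [hB0, show B (-1) = y - ⁅g, x⁆ by rw [h]; abel, lie_sub, ← lie_skew g x, lie_neg]
      rw [hxy', lie_neg, lie_neg, lie_smul, lie_smul] at hxy
      have : (2 : K) • ⁅x, ⁅x, g⁆⁆ = (2 : K) • (4 : K) • g := by
        linear_combination (norm := module) -hxy
      rw [smul_right_injective L (two_ne_zero (α := K)) this, hxy']
      module)
    (by rw [hB0, hB1, h2g])
    (by
      have h := hg 1
      rw [one_add_one_eq_two, sub_self, hB0, hB1] at h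
      rw [hB1, show B 2 = x + ⁅g, y⁆ by rw [h]; abel, add_lie, ← lie_skew ⁅g, y⁆ y,
        ← lie_skew g y, lie_neg, neg_neg]
      rw [h2g, lie_smul, lie_smul] at hyx
      have : (2 : K) • ⁅y, ⁅y, g⁆⁆ = (2 : K) • (4 : K) • g := by
        linear_combination (norm := module) hyx
      rw [smul_right_injective L (two_ne_zero (α := K)) this, hxy']
      module)
  exact ⟨lift B (fun n => (2⁻¹ : K) • ⁅B n, B 0⁆)
    (fun l m => by rw [smul_inv_smul₀ two_ne_zero, lie_A_A_eq hs hg l m])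
    (lie_G_A_eq hs hg) (lie_G_G_eq hs hg), lift_A .., lift_A ..⟩

end lift
end OnsagerAlgebra


/-! ### Representations of the tetrahedron algebra by 2 × 2 involutions. -/

namespace TetrahedronAlgebra

attribute [local instance] LieRing.ofAssociativeRing

section lift
variable {K L : Type*} [CommRing K] [LieRing L] [LieAlgebra K L]

/-- The Lie algebra morphism out of the tetrahedron algebra determined by a family satisfying
the defining relations. -/
theorem exists_lieHom (x : Fin 4 → Fin 4 → L) (h1 : ∀ i j, i ≠ j → x i j + x j i = 0)
    (h2 : ∀ i j k, i ≠ j → j ≠ k → i ≠ k → ⁅x i j, x j k⁆ = (2 : K) • (x i j + x j k))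
    (h3 : ∀ h i j k, h ≠ i → h ≠ j → h ≠ k → i ≠ j → i ≠ k → j ≠ k →
      ⁅x h i, ⁅x h i, ⁅x h i, x j k⁆⁆⁆ = (4 : K) • ⁅x h i, x j k⁆) :
    ∃ φ : TetrahedronAlgebra K →ₗ⁅K⁆ L, ∀ i j hij, φ (X K i j hij) = x i j := by
  let F : FreeLieAlgebra K Index →ₗ⁅K⁆ L := FreeLieAlgebra.lift K fun p => x p.1.1 p.1.2
  have hF (i j : Fin 4) (hij : i ≠ j) : F (freeX K i j hij) = x i j :=
    FreeLieAlgebra.lift_of_apply ..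
  have hle : relationIdeal K ≤ F.ker := by
    refine LieSubmodule.lieSpan_le.mpr ?_
    rintro _ (⟨i, j, hij⟩ | ⟨i, j, k, hij, hjk, hik⟩ | ⟨h, i, j, k, hhi, hhj, hhk, hij, hik, hjk⟩) <;>
      simp only [SetLike.mem_coe, LieHom.mem_ker, map_add, map_sub, map_smul, LieHom.map_lie, hF]
    · exact h1 i j hij
    · rw [h2 i j k hij hjk hik, sub_self]
    · rw [h3 h i j k hhi hhj hhk hij hik hjk, sub_self]
  let φ : TetrahedronAlgebra K →ₗ[K] L :=
    (relationIdeal K).toSubmodule.liftQ (F : FreeLieAlgebra K Index →ₗ[K] L) hle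
  refine ⟨{ φ with map_lie' := fun {x y} => ?_ }, fun i j hij => hF i j hij⟩
  obtain ⟨x, rfl⟩ := LieSubmodule.Quotient.surjective_mk' _ x
  obtain ⟨y, rfl⟩ := LieSubmodule.Quotient.surjective_mk' _ y
  exact F.map_lie x y

end lift

section matrix
variable {K F : Type*} [Field K] [Field F] [Algebra K F]

/-- The trace zero matrix having eigenvectors `(a, 1)` and `(b, 1)` with eigenvalues `1`, `-1`. -/
def involution (a b : F) : Matrix (Fin 2) (Fin 2) F :=
  (a - b)⁻¹ • !![-(a + b), 2 * a * b; -2, a + b]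

theorem involution_mul_self {a b : F} (hab : a ≠ b) : involution a b * involution a b = 1 := by
  have : a - b ≠ 0 := sub_ne_zero.mpr hab
  ext i j
  fin_cases i <;> fin_cases j <;> simp [involution, Matrix.mul_apply] <;> field_simp <;> ring

theorem lie_involution {a b c : F} (hab : a ≠ b) (hbc : b ≠ c) :
    ⁅involution a b, involution b c⁆ = (2 : K) • (involution a b + involution b c) := by
  have h1 : a - b ≠ 0 := sub_ne_zero.mpr hab
  have h2 : b - c ≠ 0 := sub_ne_zero.mpr hbc
  rw [show (2 : K) • (involution a b + involution b c) =
    (2 : F) • (involution a b + involution b c) by simp only [two_smul]]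
  ext i j
  fin_cases i <;> fin_cases j <;> simp [involution, Ring.lie_def] <;>
    field_simp <;> ring

/-- Left and right multiplication by x are commuting involutions P and Q, so (P - Q)³ = 4(P - Q). -/
theorem lie_lie_lie_of_mul_self {R : Type*} [Ring R] [Algebra K R] {x : R} (hx : x * x = 1) (y : R) :
    ⁅x, ⁅x, ⁅x, y⁆⁆⁆ = (4 : K) • ⁅x, y⁆ := by
  have h1 (z : R) : x * (x * z) = z := by rw [← mul_assoc, hx, one_mul]
  have h2 : (4 : K) • ⁅x, y⁆ = (4 : ℕ) • ⁅x, y⁆ := by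
    rw [← Nat.cast_smul_eq_nsmul K]; norm_num
  rw [h2]
  simp only [Ring.lie_def, mul_sub, sub_mul, mul_assoc, h1, hx, mul_one]
  abel

theorem exists_lieHom_matrix (p : Fin 4 → F) (hp : Function.Injective p) :
    ∃ φ : TetrahedronAlgebra K →ₗ⁅K⁆ Matrix (Fin 2) (Fin 2) F,
      ∀ i j hij, φ (X K i j hij) = involution (p i) (p j) := by
  refine exists_lieHom _ (fun i j hij => ?_) (fun i j k hij hjk _ => ?_) ?_
  · rw [involution, involution, ← neg_sub (p i), inv_neg]
    ext i j
    fin_cases i <;> fin_cases j <;> simp <;> ring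
  · exact lie_involution (hp.ne hij) (hp.ne hjk)
  · exact fun h i j k hhi _ _ _ _ _ => lie_lie_lie_of_mul_self (involution_mul_self (hp.ne hhi)) _

end matrix
end TetrahedronAlgebra

/-! ### The loop representation and injectivity. -/

namespace OnsagerAlgebra

section matrix

attribute [local instance] LieRing.ofAssociativeRing

variable {K F : Type*} [Field K] [Field F] [Algebra K F]

/-- The image of `A m` in the loop algebra with loop parameter `s`. -/
def loopMatrix (s : F) (m : ℤ) : Matrix (Fin 2) (Fin 2) F := !![0, s ^ m; s ^ (-m), 0]

theorem lie_loopMatrix {s : F} (hs : s ≠ 0) (l m : ℤ) : ⁅loopMatrix s l, loopMatrix s m⁆ =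
    !![s ^ (l - m) - s ^ (m - l), 0; 0, s ^ (m - l) - s ^ (l - m)] := by
  ext i j : 1
  fin_cases i <;> fin_cases j <;>
    simp [loopMatrix, Ring.lie_def, zpow_sub₀ hs] <;> field_simp

theorem lie_lie_loopMatrix {s : F} (hs : s ≠ 0) (m : ℤ) :
    ⁅⁅loopMatrix s 1, loopMatrix s 0⁆, loopMatrix s m⁆ =
      (2 : K) • (loopMatrix s (m + 1) - loopMatrix s (m - 1)) := by
  rw [lie_loopMatrix hs, two_smul]
  ext i j : 1
  fin_cases i <;> fin_cases j <;>
    simp [loopMatrix, Ring.lie_def, zpow_add₀ hs, zpow_sub₀ hs] <;> field_simp <;> ring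

variable [CharZero K]

theorem apply_A_eq_loopMatrix {s : F} (hs : s ≠ 0)
    (φ : OnsagerAlgebra K →ₗ⁅K⁆ Matrix (Fin 2) (Fin 2) F)
    (h0 : φ (A K 0) = loopMatrix s 0) (h1 : φ (A K 1) = loopMatrix s 1) (m : ℤ) :
    φ (A K m) = loopMatrix s m := by
  have hrec (m : ℤ) (hm : φ (A K m) = loopMatrix s m) :
      φ (A K (m + 1)) - φ (A K (m - 1)) = loopMatrix s (m + 1) - loopMatrix s (m - 1) := by
    apply smul_right_injective _ (two_ne_zero (α := K))
    have h := product_A_A K 1 0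
    rw [sub_zero, ← lie_def] at h
    have h' := product_GInt_A K 1 m
    rw [← lie_def] at h'
    simp only
    rw [← lie_lie_loopMatrix hs, ← h0, ← h1, ← hm, ← LieHom.map_lie, h, ← LieHom.map_lie,
      smul_lie, h', map_smul, map_sub]
  suffices h : φ (A K m) = loopMatrix s m ∧ φ (A K (m + 1)) = loopMatrix s (m + 1) from h.1
  induction m with
  | zero => exact ⟨h0, h1⟩
  | succ i ih =>
    have := hrec _ ih.2
    rw [add_sub_cancel_right, ih.1, sub_left_inj] at this
    exact ⟨ih.2, this⟩
  | pred i ih =>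
    have := hrec _ ih.1
    rw [ih.2, sub_right_inj] at this
    rw [sub_add_cancel]
    exact ⟨this, ih.1⟩

/-- Coordinates are read off the image: A's live off the diagonal and G's on it, so the (0, 1) entry
gives the A coefficients and the (0, 0) entry the G coefficients. -/
theorem injective_of_apply_eq_loopMatrix {s : F} (hs : s ≠ 0) (c : ℤ → F →ₗ[K] K)
    (hc : ∀ m n : ℤ, c m (s ^ n) = if n = m then 1 else 0)
    (φ : OnsagerAlgebra K →ₗ⁅K⁆ Matrix (Fin 2) (Fin 2) F)
    (h0 : φ (A K 0) = loopMatrix s 0) (h1 : φ (A K 1) = loopMatrix s 1) :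
    Function.Injective φ := by
  have hA := apply_A_eq_loopMatrix hs φ h0 h1
  have hG (l : ℕ+) : (2 : K) • φ (G K l) =
      !![s ^ (l : ℤ) - s ^ (-l : ℤ), 0; 0, s ^ (-l : ℤ) - s ^ (l : ℤ)] := by
    have h := product_A_A K l 0
    rw [sub_zero, ← lie_def, GInt_coe] at h
    rw [← map_smul, ← h, LieHom.map_lie, hA, hA, lie_loopMatrix hs, sub_zero, zero_sub]
  have hcA (x : OnsagerAlgebra K) (m : ℤ) : c m (φ x 0 1) = (basis K).repr x (Sum.inl m) := by
    induction x using induction_basis with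
    | zero => simp
    | add x y hx hy => simp [hx, hy]
    | smul d i =>
      rw [map_smul, map_smul, Matrix.smul_apply, map_smul, Finsupp.smul_apply]
      congr 1
      rcases i with n | l
      · change c m (φ (A K n) 0 1) = _
        rw [hA]
        simp [loopMatrix, hc, Finsupp.single_apply]
      · change c m (φ (G K l) 0 1) = _
        have h := congr_arg (fun M => M 0 1) (hG l)
        simp only [Matrix.smul_apply] at h
        rw [(smul_eq_zero.mp h).resolve_left two_ne_zero]
        simp
  -- The factor 2 compensates for φ (G l) having (0, 0) entry (s ^ l - s ^ (-l)) / 2. As l is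
  -- positive, only the positive power of s contributes.
  have hcG (x : OnsagerAlgebra K) (l : ℕ+) :
      (2 : K) • c l (φ x 0 0) = (basis K).repr x (Sum.inr l) := by
    induction x using induction_basis with
    | zero => simp
    | add x y hx hy => simp [← hx, ← hy, mul_add]
    | smul d i =>
      rw [map_smul, map_smul, Matrix.smul_apply, map_smul, Finsupp.smul_apply, smul_comm]
      congr 1
      rcases i with n | k
      · change (2 : K) • c l (φ (A K n) 0 0) = _
        rw [hA]
        simp [loopMatrix]
      · change (2 : K) • c l (φ (G K k) 0 0) = _
        have h := congr_arg (fun M => c l (M 0 0)) (hG k)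
        have hne : -(k : ℤ) ≠ l := by
          have := l.pos; have := k.pos; omega
        simp only [Matrix.smul_apply, map_smul] at h
        rw [h]
        simp [hc, Finsupp.single_apply, hne, -zpow_natCast, -zpow_neg]
  refine (injective_iff_map_eq_zero φ).mpr fun x hx => (basis K).repr.injective ?_
  ext (m | l)
  · simp [← hcA, hx]
  · simp [← hcG, hx]

end matrix

variable {K : Type*} [Field K] [CharZero K]

/-- G 1 is half of [A 1, A 0], and bracketing with it reaches every A m in both directions; then G n
is half of [A n, A 0]. -/
theorem range_eq_lieSpan {L : Type*} [LieRing L] [LieAlgebra K L] (φ : OnsagerAlgebra K →ₗ⁅K⁆ L) :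
    φ.range = LieSubalgebra.lieSpan K L {φ (A K 0), φ (A K 1)} := by
  set S := LieSubalgebra.lieSpan K L {φ (A K 0), φ (A K 1)}
  refine le_antisymm ?_ (LieSubalgebra.lieSpan_le.mpr ?_)
  · have h0 : φ (A K 0) ∈ S := LieSubalgebra.subset_lieSpan (by simp)
    have h1 : φ (A K 1) ∈ S := LieSubalgebra.subset_lieSpan (by simp)
    have hG (n : ℤ) (hn : φ (A K n) ∈ S) : φ (GInt K n) ∈ S := by
      have h := product_A_A K n 0
      rw [sub_zero, ← lie_def] at h
      rw [← inv_smul_smul₀ (two_ne_zero (α := K)) (GInt K n), ← h, map_smul, LieHom.map_lie]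
      exact S.smul_mem _ (S.lie_mem hn h0)
    have hrec (m : ℤ) (hm : φ (A K m) ∈ S) : φ (A K (m + 1)) - φ (A K (m - 1)) ∈ S := by
      have h := product_GInt_A K 1 m
      rw [← lie_def] at h
      rw [← map_sub, ← h, LieHom.map_lie]
      exact S.lie_mem (hG 1 h1) hm
    have hA (m : ℤ) : φ (A K m) ∈ S := by
      suffices h : φ (A K m) ∈ S ∧ φ (A K (m + 1)) ∈ S from h.1
      induction m with
      | zero => exact ⟨h0, h1⟩
      | succ i ih =>
        have := hrec _ ih.2
        rw [add_sub_cancel_right] at this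
        exact ⟨ih.2, by simpa using S.add_mem this ih.1⟩
      | pred i ih =>
        have := hrec _ ih.1
        rw [sub_add_cancel]
        exact ⟨by simpa using S.sub_mem ih.2 this, ih.1⟩
    rintro _ ⟨x, rfl⟩
    change φ x ∈ S
    induction x using induction_basis with
    | zero => simp
    | add x y hx hy => rw [map_add]; exact S.add_mem hx hy
    | smul c i =>
      rw [map_smul]
      refine S.smul_mem c ?_
      rcases basis_eq K i with ⟨m, hi⟩ | ⟨l, hi⟩ <;> rw [hi]
      exacts [hA m, hG l (hA l)]
  · rintro _ (rfl | rfl)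
    exacts [φ.mem_range_self _, φ.mem_range_self _]

end OnsagerAlgebra

theorem TetrahedronAlgebra.lie_lie_lie_X (K : Type*) [CommRing K] (h i j k : Fin 4)
    (hhi : h ≠ i) (hhj : h ≠ j) (hhk : h ≠ k) (hij : i ≠ j) (hik : i ≠ k) (hjk : j ≠ k) :
    ⁅X K h i hhi, ⁅X K h i hhi, ⁅X K h i hhi, X K j k hjk⁆⁆⁆ =
      (4 : K) • ⁅X K h i hhi, X K j k hjk⁆ := by
  have h := LieSubmodule.subset_lieSpan (R := K) (L := FreeLieAlgebra K Index)
    (IsRelator.dolanGrady (K := K) h i j k hhi hhj hhk hij hik hjk)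
  exact sub_eq_zero.mp ((LieSubmodule.Quotient.mk_eq_zero (N := relationIdeal K)).mpr h)

/-- There is an extension field, namely that of Laurent series, having a parameter whose powers are
separated by linear functionals. -/
theorem exists_zpow_dual.{u} (K : Type u) [Field K] :
    ∃ (F : Type u) (_ : Field F) (_ : Algebra K F) (s : F) (c : ℤ → F →ₗ[K] K),
      ∀ m n : ℤ, c m (s ^ n) = if n = m then 1 else 0 := by
  refine ⟨LaurentSeries K, inferInstance, HahnSeries.instAlgebra, HahnSeries.single 1 1, fun m =>
    { toFun f := f.coeff m
      map_add' _ _ := rfl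
      map_smul' _ _ := rfl }, fun m n => ?_⟩
  rw [← RatFunc.single_zpow]
  simp [HahnSeries.coeff_single, eq_comm]

/-! ### Specialization at four points and the isomorphism. -/

section
open TetrahedronAlgebra OnsagerAlgebra
attribute [local instance] LieRing.ofAssociativeRing

theorem injective_of_apply_A_eq_X {K F : Type*} [Field K] [CharZero K] [Field F] [Algebra K F]
    {s : F} {c : ℤ → F →ₗ[K] K} (hc : ∀ m n : ℤ, c m (s ^ n) = if n = m then 1 else 0)
    {h i j k : Fin 4}
    (hhi : h ≠ i) (hhj : h ≠ j) (hhk : h ≠ k) (hij : i ≠ j) (hik : i ≠ k) (hjk : j ≠ k)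
    (φ : OnsagerAlgebra K →ₗ⁅K⁆ TetrahedronAlgebra K)
    (h0 : φ (A K 0) = X K h i hhi) (h1 : φ (A K 1) = X K j k hjk) : Function.Injective φ := by
  have hs : s ≠ 0 := fun e => by simpa [e] using hc 1 1
  have hs1 : s ≠ 1 := fun e => by
    have h1 := hc 1 1
    have h0 := hc 1 0
    simp [e] at h1 h0
    simp [h0] at h1
  have hs2 : s ≠ -1 := fun e => by
    have h1 := hc 0 1
    have h2 := hc 0 0
    rw [zpow_one, e, map_neg] at h1
    rw [zpow_zero] at h2
    simp [h2] at h1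
  have : CharZero F := charZero_of_injective_algebraMap (algebraMap K F).injective
  have h2 : (2 : F) ≠ 0 := two_ne_zero
  have hneg (x : F) (hx : x ≠ 0) : x ≠ -x := fun e => by
    have : 2 * x = 0 := by linear_combination e
    exact (mul_ne_zero h2 hx) this
  -- With b = -a the involution becomes antidiagonal; a = -1 and a = -s give the loop matrices of A
  -- 0 and A 1. Distinctness of the points needs s ≠ 0, 1, -1.
  let p : Fin 4 → F := fun l => if l = h then -1 else if l = i then 1 else if l = j then -s else s
  have hp : Function.Injective p := by
    have e1 := hneg 1 one_ne_zero
    have e2 := hneg s hs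
    have e3 : (1 : F) ≠ -s := fun e => hs2 (by rw [e, neg_neg])
    have e4 : -(1 : F) ≠ -s := fun e => hs1 (neg_injective e.symm)
    intro a b hab
    simp only [p] at hab
    split_ifs at hab
    all_goals first | omega | exact absurd hab ‹_› | exact absurd hab.symm ‹_›
  obtain ⟨ψ, hψ⟩ := exists_lieHom_matrix (K := K) p hp
  have hinj := injective_of_apply_eq_loopMatrix hs c hc (ψ.comp φ) (by
    rw [LieHom.comp_apply, h0, hψ, show p h = -1 by simp [p], show p i = 1 by simp [p, hhi.symm]]
    ext a b : 1
    fin_cases a <;> fin_cases b <;> simp [involution, loopMatrix] <;> field_simp <;> ring) (by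
    rw [LieHom.comp_apply, h1, hψ, show p j = -s by simp [p, hhj.symm, hij.symm],
      show p k = s by simp [p, hhk.symm, hik.symm, hjk.symm]]
    have : -s - s ≠ 0 := sub_ne_zero.mpr (hneg s hs).symm
    ext a b : 1
    fin_cases a <;> fin_cases b <;> simp [involution, loopMatrix] <;> field_simp <;> ring)
  rw [LieHom.coe_comp] at hinj
  exact hinj.of_comp

end

theorem mainTheorem5 (K : Type*) [Field K] [CharZero K] (h i j k : Fin 4)
    (hhi : h ≠ i) (hhj : h ≠ j) (hhk : h ≠ k) (hij : i ≠ j) (hik : i ≠ k) (hjk : j ≠ k) :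
    Nonempty
      (LieSubalgebra.lieSpan K (TetrahedronAlgebra K)
          {TetrahedronAlgebra.X K h i hhi, TetrahedronAlgebra.X K j k hjk} ≃ₗ⁅K⁆
        OnsagerAlgebra K) := by
  obtain ⟨φ, h0, h1⟩ := OnsagerAlgebra.exists_lieHom_of_dolanGrady
    (TetrahedronAlgebra.X K h i hhi) (TetrahedronAlgebra.X K j k hjk)
    (TetrahedronAlgebra.lie_lie_lie_X K h i j k hhi hhj hhk hij hik hjk)
    (TetrahedronAlgebra.lie_lie_lie_X K j k h i hjk hhj.symm hij.symm hhk.symm hik.symm hhi)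
  obtain ⟨F, _, _, s, c, hc⟩ := exists_zpow_dual K
  have hφ := injective_of_apply_A_eq_X hc hhi hhj hhk hij hik hjk φ h0 h1
  rw [← h0, ← h1, ← OnsagerAlgebra.range_eq_lieSpan]
  exact ⟨(φ.equivRangeOfInjective hφ).symm⟩
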